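/- A \emph{token swapping instance} consists of a finite graph $G$ with one token on every vertex and, for every token, a destination vertex, different tokens having different destinations. A \emph{swap} exchanges the tokens on two adjacent vertices; a swapping sequence \emph{solves} the instance if it brings every token to its destination, and its length is its number of swaps. There is a constant $C$ such that for every $n\ge 0$ there are a connected graph $\mathrm{PN}$ (empty for $n=0$) and an integer $T\ge 0$ as follows. The vertices of $\mathrm{PN}$ are $n$ inputs $V_{\mathrm{in}}=\{x_1,\dots,x_n\}$, pairwise non-adjacent, $n$ outputs $V_{\mathrm{out}}=\{y_1,\dots,y_n\}$, and at most $Cn^3$ inner vertices $V_{\mathrm{PN}}$. The tokens starting on $V_{\mathrm{PN}}\cup V_{\mathrm{out}}$ (filler tokens) have fixed, pairwise different destinations, which are the vertices of $V_{\mathrm{in}}\cup V_{\mathrm{PN}}$. For a permutation $\pi$ of $\{1,\dots,n\}$, let $I(\pi)$ be the instance on $\mathrm{PN}$ in which moreover the token starting on $x_i$ has destination $y_{\pi(i)}$. Then: 1. For every even permutation $\pi$, a shortest sequence solving $I(\pi)$ has length exactly $T$. 2. For every other permutation $\pi$, every sequence solving $I(\pi)$ has length at least $T+1$. 3. The same holds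 for every extension of $\mathrm{PN}$, in the following sense. Let $H$ be any finite graph that shares with $\mathrm{PN}$ exactly the vertices $V_{\mathrm{in}}$, and consider instances on $\mathrm{PN}\cup H$ in which the filler tokens are as before, the $n$ tokens with destinations in $V_{\mathrm{out}}$ start on arbitrary vertices of $H$, and the other tokens starting on $H$ have the vertices of $H$ outside $V_{\mathrm{in}}$ as destinations, in any order. Say that the tokens on $H$ are \emph{evenly delivered} if, for some even $\pi$, the token with destination $y_{\pi(i)}$ is on $x_i$ for all $i$, and every token whose destination is a vertex of $H$ outside $V_{\mathrm{in}}$ is there. Then: (a) If the tokens on $H$ are evenly delivered at the start, a shortest solving sequence has length exactly $T$; otherwise, every solving sequence has length at least $T+1$. (b) If a sequence of swaps along edges of $H$ leads from the start to a situation in which the tokens on $H$ are evenly delivered, then it can be completed to a solving sequence by $T$ further swaps, all along edges of $\mathrm{PN}$. (c) Every solving sequence contains at least $T$ swaps along edges of $\mathrm{PN}$, and it contains at least $T+1$ of them unless its swaps along edges of $H$, performed alone and in their order from the start, lead to a situation in which the tokens on $H$ are evenly delivered. -/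

import Mathlib

/-! ### Token swapping

A configuration on a vertex set `V` is recorded by the map `c : V → D` that sends every vertex
to the destination of the token which it currently holds. -/

/-- The configuration reached from `c` by performing the swaps of `s` one after the other; the
swap `(u, v)` exchanges the tokens on `u` and `v`. -/
def applySwaps {V D : Type*} [DecidableEq V] (c : V → D) (s : List (V × V)) : V → D :=
  s.foldl (fun c e => c ∘ Equiv.swap e.1 e.2) c

/-- All swaps of `s` take place along edges of `G`. -/
def IsSwapSeq {V : Type*} (G : SimpleGraph V) (s : List (V × V)) : Prop :=
  ∀ e ∈ s, G.Adj e.1 e.2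

/-- `s` is a sequence of swaps along edges of `G` that brings every token to its destination. -/
def Solves {V : Type*} [DecidableEq V] (G : SimpleGraph V) (c : V → V) (s : List (V × V)) : Prop :=
  IsSwapSeq G s ∧ applySwaps c s = id

/-- The lengths of the swap sequences that solve the token swapping instance `(G, c)`. -/
def solutionLengths {V : Type*} [DecidableEq V] (G : SimpleGraph V) (c : V → V) : Set ℕ :=
  {k | ∃ s : List (V × V), Solves G c s ∧ s.length = k}

/-! ### Networks -/

/-- The vertices of a network with `n` inputs, `m` inner vertices and `n` outputs. -/
inductive NetVertex (n m : ℕ) : Type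
  | input (i : Fin n)
  | inner (j : Fin m)
  | output (k : Fin n)
  deriving DecidableEq

/-- A network: a graph together with a fixed destination, which is an input or an inner vertex,
for each filler token, that is, each token starting on an inner vertex or on an output. Different
filler tokens have different destinations. -/
structure Network (n m : ℕ) where
  /-- the underlying graph -/
  graph : SimpleGraph (NetVertex n m)
  /-- `inl j`, `inr k` on the left stand for the tokens starting on inner vertex `j`, output `k`;
  `inl i`, `inr j` on the right stand for the destinations input `i`, inner vertex `j` -/
  fillerDest : Fin m ⊕ Fin n ≃ Fin n ⊕ Fin m

namespace Network

variable {n m : ℕ} (N : Network n m)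

/-- The vertex that is the destination of a filler token. -/
def fillerVertex (x : Fin m ⊕ Fin n) : NetVertex n m :=
  match N.fillerDest x with
  | Sum.inl i => NetVertex.input i
  | Sum.inr j => NetVertex.inner j

/-- The starting configuration for the assignment `π`: the token on input `i` has to go to output
`π i`, the filler tokens have their fixed destinations. -/
def config (π : Equiv.Perm (Fin n)) : NetVertex n m → NetVertex n m
  | NetVertex.input i => NetVertex.output (π i)
  | NetVertex.inner j => N.fillerVertex (Sum.inl j)
  | NetVertex.output k => N.fillerVertex (Sum.inr k)

/-! Extensions. The graph `H` has the inputs `Fin n` of the network and further vertices `W` as its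
vertices. The union has the vertices of the network and those of `W`. -/

/-- The position in the union of a vertex of `H`. -/
def hostVertex (n m : ℕ) (W : Type*) : Fin n ⊕ W → NetVertex n m ⊕ W
  | Sum.inl i => Sum.inl (NetVertex.input i)
  | Sum.inr w => Sum.inr w

/-- The network as a graph on the vertices of the union. -/
def netGraph (W : Type*) : SimpleGraph (NetVertex n m ⊕ W) :=
  N.graph.map Sum.inl

/-- The graph `H` as a graph on the vertices of the union. -/
def hostGraph (m : ℕ) {W : Type*} (H : SimpleGraph (Fin n ⊕ W)) :
    SimpleGraph (NetVertex n m ⊕ W) :=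
  H.map (hostVertex n m W)

/-- The extension of the network by `H`: the union of the two graphs. -/
def extend {W : Type*} (H : SimpleGraph (Fin n ⊕ W)) : SimpleGraph (NetVertex n m ⊕ W) :=
  N.netGraph W ⊔ hostGraph m H

/-- The destination in the union of a token that starts in `H`: `inl k` stands for output `k`, and
`inr w` for the vertex `w` of `H`. (The inputs are the destinations of filler tokens.) -/
def hostDest (n m : ℕ) (W : Type*) : Fin n ⊕ W → NetVertex n m ⊕ W
  | Sum.inl k => Sum.inl (NetVertex.output k)
  | Sum.inr w => Sum.inr w

/-- A starting configuration of the extension. The filler tokens are as in the network alone. The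
tokens on `H` are distributed by an arbitrary bijection `τ`: the token on the vertex `x` of `H` has
destination `hostDest (τ x)`; so the tokens for the outputs may start anywhere in `H`, and the
other tokens on `H` go to the vertices of `H` that are not inputs. -/
def extConfig {W : Type*} (τ : Equiv.Perm (Fin n ⊕ W)) : NetVertex n m ⊕ W → NetVertex n m ⊕ W
  | Sum.inl (NetVertex.input i) => hostDest n m W (τ (Sum.inl i))
  | Sum.inl (NetVertex.inner j) => Sum.inl (N.fillerVertex (Sum.inl j))
  | Sum.inl (NetVertex.output k) => Sum.inl (N.fillerVertex (Sum.inr k))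
  | Sum.inr w => hostDest n m W (τ (Sum.inr w))

/-- The situation on `H` in which the token on input `i` is the one for output `π i`, and all
the other tokens on `H` have reached their destinations. -/
def delivered {n : ℕ} (W : Type*) (π : Equiv.Perm (Fin n)) : Equiv.Perm (Fin n ⊕ W) :=
  Equiv.sumCongr π (Equiv.refl W)

open Classical in
/-- The swaps of `s` along edges of the network, in their order. -/
noncomputable def netSwaps {W : Type*} (s : List ((NetVertex n m ⊕ W) × (NetVertex n m ⊕ W))) :
    List ((NetVertex n m ⊕ W) × (NetVertex n m ⊕ W)) :=
  s.filter fun e => decide ((N.netGraph W).Adj e.1 e.2)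

open Classical in
/-- The swaps of `s` along edges of `H`, in their order. -/
noncomputable def hostSwaps {W : Type*} (H : SimpleGraph (Fin n ⊕ W))
    (s : List ((NetVertex n m ⊕ W) × (NetVertex n m ⊕ W))) :
    List ((NetVertex n m ⊕ W) × (NetVertex n m ⊕ W)) :=
  s.filter fun e => decide ((hostGraph m H).Adj e.1 e.2)

end Network

/-! The network is a stack of levels of size `n`, the inputs at level 0 and the outputs at the top
level `L`, with all edges between consecutive levels.

Lower bound: take as potential the sum of the levels of the tokens destined for outputs, where all
of `H` counts as level 0. It rises from 0 to `n * L`; a swap in `H` leaves it unchanged and a swap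
in the network raises it by at most 1 (`IsLayered.height_le`). Hence `T = n * L`.

Equality: each network swap must then lift an output token past a token that is not one. So the
network never returns an output token to `H` and never permutes the other tokens of `H`, and the
swaps in `H` alone must make a delivery (`Tracks.applySwaps`, `exists_delivered_of_tracks`). Its
permutation is even: the fillers are fixed, so its sign is determined by the parity of the number of
network swaps, which is that of a solution for the identity (`sign_eq_one_of_comp_eq_id`).

Upper bound: sending all tokens up two levels through one hub vertex, in the order of an `n`-cycle,
realises that cycle by upward moves only. If the order always begins with the same element, the
fillers move in the same way for every cycle (`relays_isFullCycle`). Every even permutation is a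
product of exactly `2 * n` such cycles (`exists_list_isFullCycle`), so `L = 4 * n` suffices for `n >
0`. -/

/-! ### Swap sequences as permutations -/

section SwapSequences

variable {V D : Type*} [DecidableEq V]

/-- The product of the transpositions of a swap sequence. -/
def swapProd (s : List (V × V)) : Equiv.Perm V :=
  (s.map fun e => Equiv.swap e.1 e.2).prod

@[simp] lemma swapProd_nil : swapProd ([] : List (V × V)) = 1 := rfl

@[simp] lemma swapProd_cons (e : V × V) (s : List (V × V)) :
    swapProd (e :: s) = Equiv.swap e.1 e.2 * swapProd s := by
  simp [swapProd]

@[simp] lemma swapProd_append (s t : List (V × V)) :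
    swapProd (s ++ t) = swapProd s * swapProd t := by
  simp [swapProd]

@[simp] lemma applySwaps_nil (c : V → D) : applySwaps c [] = c := rfl

@[simp] lemma applySwaps_cons (c : V → D) (e : V × V) (s : List (V × V)) :
    applySwaps c (e :: s) = applySwaps (c ∘ Equiv.swap e.1 e.2) s := rfl

lemma applySwaps_append (c : V → D) (s t : List (V × V)) :
    applySwaps c (s ++ t) = applySwaps (applySwaps c s) t := by
  simp [applySwaps]

/-- Hence the token starting on `v` ends on `(swapProd s)⁻¹ v`, and `s` solves `c` exactly when `c`
is the inverse of `swapProd s`. -/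
lemma applySwaps_eq_comp_swapProd (c : V → D) (s : List (V × V)) :
    applySwaps c s = c ∘ swapProd s := by
  induction s generalizing c with
  | nil => rfl
  | cons e s ih => rw [applySwaps_cons, ih, swapProd_cons]; rfl

lemma sign_swapProd [Fintype V] {s : List (V × V)} (hs : ∀ e ∈ s, e.1 ≠ e.2) :
    Equiv.Perm.sign (swapProd s) = (-1) ^ s.length := by
  induction s with
  | nil => simp
  | cons e s ih =>
    rw [swapProd_cons, map_mul, ih fun e he => hs e (List.mem_cons_of_mem _ he),
      Equiv.Perm.sign_swap (hs e List.mem_cons_self), List.length_cons, pow_succ']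

lemma applySwaps_map {V' D' : Type*} [DecidableEq V'] {f : V → V'} (hf : f.Injective)
    {g : D → D'} (s : List (V × V)) (c : V → D) (c' : V' → D') (h : c' ∘ f = g ∘ c) :
    applySwaps c' (s.map (Prod.map f f)) ∘ f = g ∘ applySwaps c s := by
  induction s generalizing c c' with
  | nil => exact h
  | cons e s ih =>
    rw [List.map_cons, applySwaps_cons, applySwaps_cons]
    refine ih _ _ ?_
    funext v
    have := congrFun h (Equiv.swap e.1 e.2 v)
    simpa [hf.map_swap] using this

omit [DecidableEq V] in
lemma applySwaps_map_of_notMem {V' D' : Type*} [DecidableEq V'] {f : V → V'}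
    (s : List (V × V)) (c' : V' → D') {x : V'} (hx : x ∉ Set.range f) :
    applySwaps c' (s.map (Prod.map f f)) x = c' x := by
  induction s generalizing c' with
  | nil => rfl
  | cons e s ih =>
    rw [List.map_cons, applySwaps_cons, ih, Function.comp_apply, Equiv.swap_apply_of_ne_of_ne]
    · rintro rfl; exact hx ⟨_, rfl⟩
    · rintro rfl; exact hx ⟨_, rfl⟩

/-- Only the summands at `u` and `v` change. With `g` marking the output tokens and `h` the level,
this is the change of height caused by a swap. -/
lemma sum_mul_swap [Fintype V] (g h : V → ℤ) {u v : V} (huv : u ≠ v) :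
    ∑ x, g (Equiv.swap u v x) * h x = ∑ x, g x * h x + (g u - g v) * (h v - h u) := by
  have : ∑ x, (g (Equiv.swap u v x) * h x - g x * h x) = (g u - g v) * (h v - h u) := by
    rw [Fintype.sum_eq_add u v huv]
    · simp; ring
    · rintro x ⟨h1, h2⟩
      rw [Equiv.swap_apply_of_ne_of_ne h1 h2, sub_self]
  rw [Finset.sum_sub_distrib] at this
  linarith

end SwapSequences

/-! ### Layered networks -/

/-- The vertices of a network as a sum type. -/
def NetVertex.equivSum (n m : ℕ) : NetVertex n m ≃ (Fin n ⊕ Fin m) ⊕ Fin n where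
  toFun
    | .input i => .inl (.inl i)
    | .inner j => .inl (.inr j)
    | .output k => .inr k
  invFun
    | .inl (.inl i) => .input i
    | .inl (.inr j) => .inner j
    | .inr k => .output k
  left_inv := by rintro (_ | _ | _) <;> rfl
  right_inv := by rintro ((_ | _) | _) <;> rfl

instance (n m : ℕ) : Fintype (NetVertex n m) :=
  Fintype.ofEquiv _ (NetVertex.equivSum n m).symm

namespace Network

variable {n m : ℕ}

/-- The vertices of the network are arranged in levels `0, …, L`, the inputs being the vertices of
level `0` and the outputs being on level `L`; edges join consecutive levels, and every even
assignment is solved by swaps each of which moves one of the tokens for the outputs up. -/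
structure IsLayered (N : Network n m) (L : ℕ) (lvl : NetVertex n m → ℕ) : Prop where
  input : ∀ i, lvl (.input i) = 0
  output : ∀ k, lvl (.output k) = L
  adj : ∀ u v, N.graph.Adj u v → lvl u = lvl v + 1 ∨ lvl v = lvl u + 1
  route : ∀ π : Equiv.Perm (Fin n), Equiv.Perm.sign π = 1 →
    ∃ s, Solves N.graph (N.config π) s ∧ s.length = n * L

/-- The level of a vertex in an extension: the vertices of `H` have level `0`. -/
def extLevel (lvl : NetVertex n m → ℕ) {W : Type*} : NetVertex n m ⊕ W → ℤ
  | .inl u => lvl u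
  | .inr _ => 0

/-- The indicator function of the outputs. -/
def outInd {W : Type*} : NetVertex n m ⊕ W → ℤ
  | .inl (.output _) => 1
  | _ => 0

lemma outInd_eq_zero_or_one {W : Type*} (x : NetVertex n m ⊕ W) : outInd x = 0 ∨ outInd x = 1 := by
  rcases x with (_ | _ | _) | _ <;> simp [outInd]

lemma outInd_eq_one_iff {W : Type*} (x : NetVertex n m ⊕ W) :
    outInd x = 1 ↔ ∃ k, x = .inl (.output k) := by
  rcases x with (_ | _ | _) | _ <;> simp [outInd]

/-- The total height of the tokens for the outputs. -/
def height (lvl : NetVertex n m → ℕ) {W : Type*} [Fintype W]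
    (c : NetVertex n m ⊕ W → NetVertex n m ⊕ W) : ℤ :=
  ∑ x, outInd (c x) * extLevel lvl x

variable {N : Network n m} {L : ℕ} {lvl : NetVertex n m → ℕ} {W : Type*}

lemma netGraph_adj {x y : NetVertex n m ⊕ W} :
    (N.netGraph W).Adj x y ↔ ∃ u v, N.graph.Adj u v ∧ Sum.inl u = x ∧ Sum.inl v = y := by
  constructor
  · exact fun h => h.2
  · exact fun h => ⟨by
      obtain ⟨u, v, huv, rfl, rfl⟩ := h
      exact fun e => huv.ne (Sum.inl_injective e), h⟩

lemma hostVertex_injective : (hostVertex n m W).Injective := by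
  rintro (_ | _) (_ | _) h <;> simp_all [hostVertex]

lemma hostGraph_adj {H : SimpleGraph (Fin n ⊕ W)} {x y : NetVertex n m ⊕ W} :
    (hostGraph m H).Adj x y ↔
      ∃ u v, H.Adj u v ∧ hostVertex n m W u = x ∧ hostVertex n m W v = y := by
  constructor
  · exact fun h => h.2
  · exact fun h => ⟨by
      obtain ⟨u, v, huv, rfl, rfl⟩ := h
      exact fun e => huv.ne (hostVertex_injective e), h⟩

lemma hostDest_injective : (hostDest n m W).Injective := by
  rintro (_ | _) (_ | _) h <;> simp_all [hostDest]

lemma extConfig_hostVertex (τ : Equiv.Perm (Fin n ⊕ W)) (x : Fin n ⊕ W) :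
    N.extConfig τ (hostVertex n m W x) = hostDest n m W (τ x) := by
  rcases x with _ | _ <;> rfl

lemma extLevel_hostVertex (h : N.IsLayered L lvl) (x : Fin n ⊕ W) :
    extLevel lvl (hostVertex n m W x) = 0 := by
  rcases x with _ | _ <;> simp [extLevel, hostVertex, h.input]

/-- All of `H` has level 0, whereas network edges change the level. So each swap is of exactly one
kind. -/
lemma IsLayered.not_adj_host (h : N.IsLayered L lvl) {H : SimpleGraph (Fin n ⊕ W)}
    {x y : NetVertex n m ⊕ W} (hxy : (N.netGraph W).Adj x y) : ¬ (hostGraph m H).Adj x y := by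
  rintro hh
  obtain ⟨u, v, huv, rfl, rfl⟩ := netGraph_adj.1 hxy
  obtain ⟨a, b, -, ha, hb⟩ := hostGraph_adj.1 hh
  have h1 := extLevel_hostVertex h a
  have h2 := extLevel_hostVertex h b
  rw [ha] at h1
  rw [hb] at h2
  simp only [extLevel] at h1 h2
  have := h.adj u v huv
  omega

/-! ### The height as a potential -/

variable [DecidableEq W]

lemma IsLayered.height_host [Fintype W] (h : N.IsLayered L lvl) {H : SimpleGraph (Fin n ⊕ W)}
    {x y : NetVertex n m ⊕ W} (hxy : (hostGraph m H).Adj x y)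
    (c : NetVertex n m ⊕ W → NetVertex n m ⊕ W) :
    height lvl (c ∘ Equiv.swap x y) = height lvl c := by
  have hne := hxy.ne
  obtain ⟨a, b, -, ha, hb⟩ := hostGraph_adj.1 hxy
  simp only [height, Function.comp_apply]
  rw [sum_mul_swap (fun x => outInd (c x)) _ hne, ← ha, ← hb, extLevel_hostVertex h,
    extLevel_hostVertex h]
  simp

lemma IsLayered.height_net_le [Fintype W] (h : N.IsLayered L lvl)
    {x y : NetVertex n m ⊕ W} (hxy : (N.netGraph W).Adj x y)
    (c : NetVertex n m ⊕ W → NetVertex n m ⊕ W) :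
    height lvl (c ∘ Equiv.swap x y) ≤ height lvl c + 1 := by
  have hne := hxy.ne
  obtain ⟨u, v, huv, rfl, rfl⟩ := netGraph_adj.1 hxy
  simp only [height, Function.comp_apply]
  rw [sum_mul_swap (fun x => outInd (c x)) _ hne]
  simp only [extLevel]
  rcases h.adj u v huv with h1 | h1 <;>
  rcases outInd_eq_zero_or_one (c (.inl u)) with h2 | h2 <;>
  rcases outInd_eq_zero_or_one (c (.inl v)) with h3 | h3 <;>
  simp [h1, h2, h3]

/-- The equality case of `height_net_le`: the lower end `u` must hold an output token and the upper
end `v` must not. -/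
lemma IsLayered.exists_of_height_net [Fintype W] (h : N.IsLayered L lvl)
    {x y : NetVertex n m ⊕ W} (hxy : (N.netGraph W).Adj x y)
    {c : NetVertex n m ⊕ W → NetVertex n m ⊕ W}
    (hc : height lvl c + 1 ≤ height lvl (c ∘ Equiv.swap x y)) :
    ∃ u v, (Equiv.swap x y : Equiv.Perm (NetVertex n m ⊕ W)) = Equiv.swap (.inl u) (.inl v) ∧
      0 < lvl v ∧ outInd (c (.inl u)) = 1 ∧ outInd (c (.inl v)) = 0 := by
  have hne := hxy.ne
  obtain ⟨u, v, huv, rfl, rfl⟩ := netGraph_adj.1 hxy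
  simp only [height, Function.comp_apply] at hc
  rw [sum_mul_swap (fun x => outInd (c x)) _ hne] at hc
  simp only [extLevel] at hc
  rcases h.adj u v huv with h1 | h1
  · refine ⟨v, u, Equiv.swap_comm _ _, by omega, ?_⟩
    rcases outInd_eq_zero_or_one (c (.inl u)) with h2 | h2 <;>
    rcases outInd_eq_zero_or_one (c (.inl v)) with h3 | h3 <;>
    simp [h1, h2, h3] at hc ⊢
  · refine ⟨u, v, rfl, by omega, ?_⟩
    rcases outInd_eq_zero_or_one (c (.inl u)) with h2 | h2 <;>
    rcases outInd_eq_zero_or_one (c (.inl v)) with h3 | h3 <;>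
    simp [h1, h2, h3] at hc ⊢

lemma IsLayered.height_le [Fintype W] (h : N.IsLayered L lvl) {H : SimpleGraph (Fin n ⊕ W)}
    {s : List ((NetVertex n m ⊕ W) × (NetVertex n m ⊕ W))} (hs : IsSwapSeq (N.extend H) s)
    (c : NetVertex n m ⊕ W → NetVertex n m ⊕ W) :
    height lvl (applySwaps c s) ≤ height lvl c + (N.netSwaps s).length := by
  induction s generalizing c with
  | nil => simp [netSwaps]
  | cons e s ih =>
    have ih := ih (fun e he => hs e (List.mem_cons_of_mem _ he)) (c ∘ Equiv.swap e.1 e.2)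
    rw [applySwaps_cons]
    rcases hs e List.mem_cons_self with he | he
    · have := h.height_net_le he c
      have hl : (N.netSwaps (e :: s)).length = (N.netSwaps s).length + 1 := by
        simp [netSwaps, he]
      rw [hl]
      push_cast
      linarith
    · have := h.height_host he c
      have hl : (N.netSwaps (e :: s)).length = (N.netSwaps s).length := by
        have : ¬ (N.netGraph W).Adj e.1 e.2 := fun h' => h.not_adj_host h' he
        simp [netSwaps, this]
      rw [hl]
      linarith

/-! ### The equality case: comparison with the swaps in `H` alone -/

/-- The configuration `c` arises from `c'` by exchanging some tokens for outputs on `H` with filler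
tokens in the network. -/
def Tracks (c c' : NetVertex n m ⊕ W → NetVertex n m ⊕ W) : Prop :=
  (∀ x, c (hostVertex n m W x) = c' (hostVertex n m W x) ∨
    outInd (c' (hostVertex n m W x)) = 1 ∧ outInd (c (hostVertex n m W x)) = 0 ∧
      ∃ u, c (hostVertex n m W x) = .inl u) ∧
  ∀ y ∉ Set.range (hostVertex n m W), ∃ u, c y = .inl u

omit [DecidableEq W] in
lemma exists_inl_of_outInd_eq_one {x : NetVertex n m ⊕ W} (hx : outInd x = 1) :
    ∃ u, x = .inl u := by
  obtain ⟨k, hk⟩ := (outInd_eq_one_iff x).1 hx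
  exact ⟨_, hk⟩

/-- The upper end `v` lies outside `H`. So `H` is affected only if `u` is an input, and then it
loses an output token and receives one bound for an input or inner vertex. -/
lemma Tracks.net (h : N.IsLayered L lvl) {c c' : NetVertex n m ⊕ W → NetVertex n m ⊕ W}
    (hc : Tracks c c') {u v : NetVertex n m} (hv : 0 < lvl v)
    (hu1 : outInd (c (.inl u)) = 1) (hv0 : outInd (c (.inl v)) = 0) :
    Tracks (c ∘ Equiv.swap (.inl u) (.inl v)) c' := by
  have hvr : (Sum.inl v : NetVertex n m ⊕ W) ∉ Set.range (hostVertex n m W) := by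
    rintro ⟨x, hx⟩
    have := extLevel_hostVertex (W := W) h x
    rw [hx] at this
    simp only [extLevel] at this
    omega
  refine ⟨fun x => ?_, fun y hy => ?_⟩
  · by_cases hx : hostVertex n m W x = .inl u
    · rw [hx, Function.comp_apply, Equiv.swap_apply_left]
      refine Or.inr ⟨?_, hv0, hc.2 _ hvr⟩
      rcases hc.1 x with h1 | h1
      · rw [← hx, ← h1, hx, hu1]
      · have := h1.2.1
        rw [hx, hu1] at this
        exact absurd this one_ne_zero
    · rw [Function.comp_apply, Equiv.swap_apply_of_ne_of_ne hx]
      · exact hc.1 x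
      · exact fun e => hvr ⟨x, e⟩
  · rw [Function.comp_apply]
    by_cases hyv : y = .inl v
    · rw [hyv, Equiv.swap_apply_right]
      exact exists_inl_of_outInd_eq_one hu1
    · by_cases hyu : y = .inl u
      · rw [hyu, Equiv.swap_apply_left]
        exact hc.2 _ hvr
      · rw [Equiv.swap_apply_of_ne_of_ne hyu hyv]
        exact hc.2 _ hy

lemma Tracks.host {c c' : NetVertex n m ⊕ W → NetVertex n m ⊕ W}
    (hc : Tracks c c') (a b : Fin n ⊕ W) :
    Tracks (c ∘ Equiv.swap (hostVertex n m W a) (hostVertex n m W b))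
      (c' ∘ Equiv.swap (hostVertex n m W a) (hostVertex n m W b)) := by
  refine ⟨fun x => ?_, fun y hy => ?_⟩
  · simp only [Function.comp_apply, ← hostVertex_injective.map_swap]
    exact hc.1 _
  · rw [Function.comp_apply, Equiv.swap_apply_of_ne_of_ne]
    · exact hc.2 y hy
    · rintro rfl; exact hy ⟨_, rfl⟩
    · rintro rfl; exact hy ⟨_, rfl⟩

/-- Since no swap can gain more than 1, a total gain equal to the number of network swaps forces
each of them to gain exactly 1, so `Tracks.net` applies to it. -/
lemma Tracks.applySwaps [Fintype W] (h : N.IsLayered L lvl) {H : SimpleGraph (Fin n ⊕ W)}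
    {s : List ((NetVertex n m ⊕ W) × (NetVertex n m ⊕ W))} (hs : IsSwapSeq (N.extend H) s)
    {c c' : NetVertex n m ⊕ W → NetVertex n m ⊕ W} (hc : Tracks c c')
    (hh : height lvl c + (N.netSwaps s).length ≤ height lvl (applySwaps c s)) :
    Tracks (applySwaps c s) (applySwaps c' (hostSwaps H s)) := by
  induction s generalizing c c' with
  | nil => exact hc
  | cons e s ih =>
    have hs' : IsSwapSeq (N.extend H) s := fun e he => hs e (List.mem_cons_of_mem _ he)
    have hle := h.height_le hs' (c ∘ Equiv.swap e.1 e.2)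
    rw [applySwaps_cons] at hh ⊢
    rcases hs e List.mem_cons_self with he | he
    · have hl : (N.netSwaps (e :: s)).length = (N.netSwaps s).length + 1 := by
        simp [netSwaps, he]
      have hl' : hostSwaps H (e :: s) = hostSwaps H s := by
        simp [hostSwaps, h.not_adj_host he]
      have hle1 := h.height_net_le he c
      rw [hl] at hh
      push_cast at hh
      obtain ⟨u, v, huv, hv, hu1, hv0⟩ := h.exists_of_height_net he (c := c) (by linarith)
      rw [hl']
      refine ih hs' ?_ (by linarith)
      rw [huv]
      exact hc.net h hv hu1 hv0
    · have hl : (N.netSwaps (e :: s)).length = (N.netSwaps s).length := by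
        have : ¬ (N.netGraph W).Adj e.1 e.2 := fun h' => h.not_adj_host h' he
        simp [netSwaps, this]
      have hl' : hostSwaps H (e :: s) = e :: hostSwaps H s := by
        simp [hostSwaps, he]
      have := h.height_host he c
      rw [hl', applySwaps_cons]
      rw [hl] at hh
      refine ih hs' ?_ (by linarith)
      obtain ⟨a, b, -, ha, hb⟩ := hostGraph_adj.1 he
      rw [← ha, ← hb]
      exact hc.host a b

lemma extConfig_comp_swap (τ : Equiv.Perm (Fin n ⊕ W)) (a b : Fin n ⊕ W) :
    N.extConfig τ ∘ Equiv.swap (hostVertex n m W a) (hostVertex n m W b) =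
      N.extConfig (τ * Equiv.swap a b) := by
  funext y
  by_cases hy : y ∈ Set.range (hostVertex n m W)
  · obtain ⟨x, rfl⟩ := hy
    rw [Function.comp_apply, ← hostVertex_injective.map_swap, extConfig_hostVertex,
      extConfig_hostVertex]
    rfl
  · rw [Function.comp_apply, Equiv.swap_apply_of_ne_of_ne]
    · rcases y with (i | _ | _) | w
      · exact absurd ⟨.inl i, rfl⟩ hy
      · rfl
      · rfl
      · exact absurd ⟨.inr w, rfl⟩ hy
    · rintro rfl; exact hy ⟨_, rfl⟩
    · rintro rfl; exact hy ⟨_, rfl⟩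

lemma exists_extConfig_eq_applySwaps {H : SimpleGraph (Fin n ⊕ W)}
    {s : List ((NetVertex n m ⊕ W) × (NetVertex n m ⊕ W))} (hs : IsSwapSeq (hostGraph m H) s)
    (τ : Equiv.Perm (Fin n ⊕ W)) : ∃ τ', applySwaps (N.extConfig τ) s = N.extConfig τ' := by
  induction s generalizing τ with
  | nil => exact ⟨τ, rfl⟩
  | cons e s ih =>
    obtain ⟨a, b, -, ha, hb⟩ := hostGraph_adj.1 (hs e List.mem_cons_self)
    rw [applySwaps_cons, ← ha, ← hb, extConfig_comp_swap]
    exact ih (fun e he => hs e (List.mem_cons_of_mem _ he)) _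

omit [DecidableEq W] in
lemma extConfig_injective :
    Function.Injective (N.extConfig : Equiv.Perm (Fin n ⊕ W) → _) := by
  intro τ τ' h
  ext1 x
  apply hostDest_injective (m := m)
  rw [← extConfig_hostVertex (N := N), ← extConfig_hostVertex (N := N), h]

omit [DecidableEq W] in
lemma fillerVertex_ne_output (x : Fin m ⊕ Fin n) (k : Fin n) : N.fillerVertex x ≠ .output k := by
  unfold fillerVertex
  split <;> simp

omit [DecidableEq W] in
lemma tracks_extConfig (τ : Equiv.Perm (Fin n ⊕ W)) : Tracks (N.extConfig τ) (N.extConfig τ) := by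
  refine ⟨fun x => Or.inl rfl, fun y hy => ?_⟩
  rcases y with (i | _ | _) | w
  · exact absurd ⟨.inl i, rfl⟩ hy
  · exact ⟨_, rfl⟩
  · exact ⟨_, rfl⟩
  · exact absurd ⟨.inr w, rfl⟩ hy

-- In the solved state each input holds a filler, so in the comparison configuration an output token
-- must stand there. A vertex of `W` holds its own token, which is not bound for the network, so no
-- exchange took place on it.
omit [DecidableEq W] in
lemma exists_delivered_of_tracks [Finite W] {τ : Equiv.Perm (Fin n ⊕ W)} (h : Tracks id (N.extConfig τ)) :
    ∃ π, τ = delivered W π := by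
  have h1 : ∀ i, ∃ k, τ (.inl i) = .inl k := by
    intro i
    rcases h.1 (.inl i) with h2 | ⟨h2, -⟩ <;> rw [extConfig_hostVertex] at h2
    · rcases hx : τ (.inl i) with k | w <;> rw [hx] at h2 <;> simp [hostVertex, hostDest] at h2
    · rcases hx : τ (.inl i) with k | w
      · exact ⟨k, rfl⟩
      · rw [hx] at h2
        simp [hostDest, outInd] at h2
  have h2 : ∀ w, τ (.inr w) = .inr w := by
    intro w
    rcases h.1 (.inr w) with h2 | ⟨-, -, u, h2⟩
    · rw [extConfig_hostVertex] at h2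
      rcases hx : τ (.inr w) with k | w' <;> rw [hx] at h2 <;> simp [hostVertex, hostDest] at h2
      rw [h2]
    · simp [hostVertex] at h2
  have h3 : Set.MapsTo τ (Set.range Sum.inl) (Set.range Sum.inl) := by
    rintro _ ⟨i, rfl⟩
    obtain ⟨k, hk⟩ := h1 i
    exact ⟨k, hk.symm⟩
  classical
  obtain ⟨⟨π, ρ⟩, hπ⟩ := Equiv.Perm.mem_sumCongrHom_range_of_perm_mapsTo_inl h3
  refine ⟨π, ?_⟩
  have h4 : ρ = 1 := by
    ext w
    have := h2 w
    rw [← hπ] at this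
    simpa using this
  rw [← hπ, h4]
  rfl

omit [DecidableEq W] in
lemma height_extConfig [Fintype W] (h : N.IsLayered L lvl) (τ : Equiv.Perm (Fin n ⊕ W)) :
    height lvl (N.extConfig τ) = 0 := by
  refine Finset.sum_eq_zero fun x _ => ?_
  rcases x with (i | j | k) | w
  · simp [extLevel, h.input]
  · have : outInd (N.extConfig τ (.inl (.inner j))) = 0 := by
      rcases hx : N.fillerVertex (.inl j) with _ | _ | _
      · simp [extConfig, hx, outInd]
      · simp [extConfig, hx, outInd]
      · exact absurd hx (fillerVertex_ne_output _ _)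
    rw [this, zero_mul]
  · have : outInd (N.extConfig τ (.inl (.output k))) = 0 := by
      rcases hx : N.fillerVertex (.inr k) with _ | _ | _
      · simp [extConfig, hx, outInd]
      · simp [extConfig, hx, outInd]
      · exact absurd hx (fillerVertex_ne_output _ _)
    rw [this, zero_mul]
  · simp [extLevel]

omit [DecidableEq W] in
lemma height_id [Fintype W] (h : N.IsLayered L lvl) :
    height lvl (id : NetVertex n m ⊕ W → _) = n * L := by
  simp only [height, id]
  rw [Fintype.sum_sum_type, ← (NetVertex.equivSum n m).symm.sum_comp, Fintype.sum_sum_type]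
  simp [NetVertex.equivSum, outInd, extLevel, h.output]

/-! ### Parity of a delivery -/

/-- The outputs as vertices of an extension. -/
def outputEmbedding (n m : ℕ) (W : Type*) : Fin n ↪ NetVertex n m ⊕ W :=
  ⟨fun k => .inl (.output k), fun _ _ h => by simpa using h⟩

lemma extConfig_delivered_eq_comp [Fintype W] (π : Equiv.Perm (Fin n)) :
    N.extConfig (delivered W π) =
      π.viaFintypeEmbedding (outputEmbedding n m W) ∘ N.extConfig (delivered W 1) := by
  have hfix : ∀ x : NetVertex n m ⊕ W, outInd x ≠ 1 →
      π.viaFintypeEmbedding (outputEmbedding n m W) x = x := by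
    intro x hx
    refine Equiv.Perm.viaFintypeEmbedding_apply_notMem_range _ _ ?_
    rintro ⟨k, hk⟩
    exact hx ((outInd_eq_one_iff x).2 ⟨k, hk.symm⟩)
  have hfill : ∀ x, outInd (.inl (N.fillerVertex x) : NetVertex n m ⊕ W) ≠ 1 := by
    intro x hx
    obtain ⟨k, hk⟩ := (outInd_eq_one_iff _).1 hx
    exact fillerVertex_ne_output x k (Sum.inl_injective hk)
  funext y
  rcases y with (i | j | k) | w
  · exact (Equiv.Perm.viaFintypeEmbedding_apply_image π (outputEmbedding n m W) i).symm
  · exact (hfix _ (hfill _)).symm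
  · exact (hfix _ (hfill _)).symm
  · exact (hfix (.inr w) (by simp [outInd])).symm

/-- The two configurations are `p⁻¹` and `q⁻¹`, and they differ by `π` acting on the outputs. So
`sign π` is the quotient of the signs of `p` and `q`. -/
lemma sign_eq_one_of_comp_eq_id [Fintype W] {π : Equiv.Perm (Fin n)}
    {p q : Equiv.Perm (NetVertex n m ⊕ W)} (hp : N.extConfig (delivered W 1) ∘ p = id)
    (hq : N.extConfig (delivered W π) ∘ q = id)
    (hpq : Equiv.Perm.sign p = Equiv.Perm.sign q) : Equiv.Perm.sign π = 1 := by
  have h1 : N.extConfig (delivered W 1) = (p⁻¹ : Equiv.Perm _) := by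
    funext y
    have := congrFun hp (p⁻¹ y)
    simpa using this
  have h2 : π.viaFintypeEmbedding (outputEmbedding n m W) * p⁻¹ * q = 1 := by
    ext1 y
    rw [extConfig_delivered_eq_comp, h1] at hq
    exact congrFun hq y
  have h3 := congrArg Equiv.Perm.sign h2
  rw [map_mul, map_mul, map_inv, hpq, inv_mul_cancel_right, map_one,
    Equiv.Perm.viaFintypeEmbedding_sign] at h3
  exact h3

omit [DecidableEq W] in
lemma extConfig_delivered_comp_inl (π : Equiv.Perm (Fin n)) :
    N.extConfig (delivered W π) ∘ Sum.inl = Sum.inl ∘ N.config π := by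
  funext y
  rcases y with _ | _ | _ <;> rfl

lemma applySwaps_map_inl {π : Equiv.Perm (Fin n)} {s : List (NetVertex n m × NetVertex n m)}
    (hs : Solves N.graph (N.config π) s) :
    applySwaps (N.extConfig (delivered W π)) (s.map (Prod.map Sum.inl Sum.inl)) = id := by
  funext y
  rcases y with u | w
  · have := congrFun (applySwaps_map (g := Sum.inl) Sum.inl_injective s _ _
      (extConfig_delivered_comp_inl (N := N) (W := W) π)) u
    rw [hs.2] at this
    exact this
  · rw [applySwaps_map_of_notMem _ _ (by simp)]
    rfl

omit [DecidableEq W] in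
lemma isSwapSeq_map_inl {s : List (NetVertex n m × NetVertex n m)} (hs : IsSwapSeq N.graph s) :
    IsSwapSeq (N.netGraph W) (s.map (Prod.map Sum.inl Sum.inl)) := by
  intro e he
  obtain ⟨e, he', rfl⟩ := List.mem_map.1 he
  exact netGraph_adj.2 ⟨_, _, hs e he', rfl, rfl⟩

lemma solves_map_inl {π : Equiv.Perm (Fin n)} {s : List (NetVertex n m × NetVertex n m)}
    (hs : Solves N.graph (N.config π) s) (H : SimpleGraph (Fin n ⊕ W)) :
    Solves (N.extend H) (N.extConfig (delivered W π)) (s.map (Prod.map Sum.inl Sum.inl)) :=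
  ⟨fun e he => Or.inl (isSwapSeq_map_inl hs.1 e he), applySwaps_map_inl hs⟩

lemma IsLayered.le_length_netSwaps [Finite W] (h : N.IsLayered L lvl)
    {H : SimpleGraph (Fin n ⊕ W)} {τ : Equiv.Perm (Fin n ⊕ W)}
    {s : List ((NetVertex n m ⊕ W) × (NetVertex n m ⊕ W))}
    (hs : Solves (N.extend H) (N.extConfig τ) s) : n * L ≤ (N.netSwaps s).length := by
  have := Fintype.ofFinite W
  have h1 := h.height_le hs.1 (N.extConfig τ)
  rw [hs.2, height_id h, height_extConfig h] at h1
  rw [zero_add] at h1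
  exact_mod_cast h1

omit [DecidableEq W] in
lemma IsLayered.length_eq_add (h : N.IsLayered L lvl) {H : SimpleGraph (Fin n ⊕ W)}
    {s : List ((NetVertex n m ⊕ W) × (NetVertex n m ⊕ W))} (hs : IsSwapSeq (N.extend H) s) :
    s.length = (N.netSwaps s).length + (hostSwaps H s).length := by
  induction s with
  | nil => rfl
  | cons e s ih =>
    have ih := ih fun e he => hs e (List.mem_cons_of_mem _ he)
    rcases hs e List.mem_cons_self with he | he
    · have : ¬ (hostGraph m H).Adj e.1 e.2 := h.not_adj_host he
      simp only [netSwaps, hostSwaps] at ih ⊢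
      simp [he, this, ih]
      omega
    · have : ¬ (N.netGraph W).Adj e.1 e.2 := fun h' => h.not_adj_host h' he
      simp only [netSwaps, hostSwaps] at ih ⊢
      simp [he, this, ih]
      omega

omit [DecidableEq W] in
lemma isSwapSeq_hostSwaps (H : SimpleGraph (Fin n ⊕ W))
    (s : List ((NetVertex n m ⊕ W) × (NetVertex n m ⊕ W))) :
    IsSwapSeq (hostGraph m H) (hostSwaps H s) := by
  intro e he
  simpa using (List.mem_filter.1 he).2

lemma IsLayered.exists_even_delivery [Finite W] (h : N.IsLayered L lvl)
    {H : SimpleGraph (Fin n ⊕ W)} {τ : Equiv.Perm (Fin n ⊕ W)}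
    {s : List ((NetVertex n m ⊕ W) × (NetVertex n m ⊕ W))}
    (hs : Solves (N.extend H) (N.extConfig τ) s) (hl : (N.netSwaps s).length ≤ n * L) :
    ∃ π : Equiv.Perm (Fin n), Equiv.Perm.sign π = 1 ∧
      applySwaps (N.extConfig τ) (hostSwaps H s) = N.extConfig (delivered W π) := by
  have := Fintype.ofFinite W
  have hl' : (N.netSwaps s).length = n * L := le_antisymm hl (h.le_length_netSwaps hs)
  have htr := (tracks_extConfig τ).applySwaps h hs.1 (by
    rw [hs.2, height_id h, height_extConfig h, hl']
    push_cast
    linarith)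
  obtain ⟨τ', hτ'⟩ := exists_extConfig_eq_applySwaps (N := N) (isSwapSeq_hostSwaps H s) τ
  rw [hτ', hs.2] at htr
  obtain ⟨π, rfl⟩ := exists_delivered_of_tracks htr
  refine ⟨π, ?_, hτ'⟩
  -- The reference solution `r` for the identity has `n * L` swaps. Undoing the swaps in `H` before
  -- `s` leaves a permutation `q` with the sign of the `n * L` network swaps of `s`.
  obtain ⟨r, hr, hrl⟩ := h.route 1 (by simp)
  refine sign_eq_one_of_comp_eq_id (N := N) (W := W)
    (p := swapProd (r.map (Prod.map Sum.inl Sum.inl)))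
    (q := (swapProd (hostSwaps H s))⁻¹ * swapProd s) ?_ ?_ ?_
  · rw [← applySwaps_eq_comp_swapProd, applySwaps_map_inl hr]
  · rw [← hτ', applySwaps_eq_comp_swapProd]
    rw [← hs.2, applySwaps_eq_comp_swapProd]
    funext y
    simp
  · rw [sign_swapProd fun e he => (isSwapSeq_map_inl hr.1 e he).ne, map_mul, map_inv,
      sign_swapProd fun e he => (hs.1 e he).ne,
      sign_swapProd fun e he => (isSwapSeq_hostSwaps H s e he).ne, h.length_eq_add hs.1, hl',
      List.length_map, hrl, add_comm, pow_add, inv_mul_cancel_left]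

lemma IsLayered.extension [Finite W] (h : N.IsLayered L lvl) (H : SimpleGraph (Fin n ⊕ W)) :
    (∀ π : Equiv.Perm (Fin n), Equiv.Perm.sign π = 1 →
      IsLeast (solutionLengths (N.extend H) (N.extConfig (delivered W π))) (n * L)) ∧
    (∀ τ : Equiv.Perm (Fin n ⊕ W),
      (¬ ∃ π : Equiv.Perm (Fin n), Equiv.Perm.sign π = 1 ∧ τ = delivered W π) →
      ∀ k ∈ solutionLengths (N.extend H) (N.extConfig τ), n * L + 1 ≤ k) ∧
    (∀ (τ : Equiv.Perm (Fin n ⊕ W)) (π : Equiv.Perm (Fin n)), Equiv.Perm.sign π = 1 →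
      ∀ h, IsSwapSeq (hostGraph m H) h →
        applySwaps (N.extConfig τ) h = N.extConfig (delivered W π) →
        ∃ p, IsSwapSeq (N.netGraph W) p ∧ p.length = n * L ∧
          Solves (N.extend H) (N.extConfig τ) (h ++ p)) ∧
    (∀ (τ : Equiv.Perm (Fin n ⊕ W))
        (s : List ((NetVertex n m ⊕ W) × (NetVertex n m ⊕ W))),
      Solves (N.extend H) (N.extConfig τ) s →
        n * L ≤ (N.netSwaps s).length ∧
        ((¬ ∃ π : Equiv.Perm (Fin n), Equiv.Perm.sign π = 1 ∧
            applySwaps (N.extConfig τ) (hostSwaps H s) = N.extConfig (delivered W π)) →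
          n * L + 1 ≤ (N.netSwaps s).length)) := by
  refine ⟨fun π hπ => ⟨?_, ?_⟩, ?_, fun τ π hπ g hg hτ => ?_, fun τ s hs => ⟨?_, fun hno => ?_⟩⟩
  · obtain ⟨s, hs, hl⟩ := h.route π hπ
    exact ⟨_, solves_map_inl hs H, by simpa using hl⟩
  · rintro k ⟨s, hs, rfl⟩
    exact (h.le_length_netSwaps hs).trans (List.length_filter_le _ _)
  · rintro τ hτ k ⟨s, hs, rfl⟩
    -- A solution of length at most `n * L` has no room for swaps in `H`, so the start is already an
    -- even delivery.
    by_contra hk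
    have hlen := h.length_eq_add hs.1
    have hle := h.le_length_netSwaps hs
    obtain ⟨π, hπ, he⟩ := h.exists_even_delivery hs (by omega)
    have hnil : hostSwaps H s = [] := List.eq_nil_of_length_eq_zero (by omega)
    rw [hnil, applySwaps_nil] at he
    exact hτ ⟨π, hπ, extConfig_injective he⟩
  · obtain ⟨s, hs, hl⟩ := h.route π hπ
    refine ⟨s.map (Prod.map Sum.inl Sum.inl), isSwapSeq_map_inl hs.1, by simpa using hl,
      fun e he => ?_, ?_⟩
    · rcases List.mem_append.1 he with he | he
      · exact Or.inr (hg e he)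
      · exact Or.inl (isSwapSeq_map_inl hs.1 e he)
    · rw [applySwaps_append, hτ, applySwaps_map_inl hs]
  · exact h.le_length_netSwaps hs
  · by_contra hk
    exact hno (h.exists_even_delivery hs (by omega))

lemma IsLayered.isLeast_solutionLengths (h : N.IsLayered L lvl) {π : Equiv.Perm (Fin n)}
    (hπ : Equiv.Perm.sign π = 1) : IsLeast (solutionLengths N.graph (N.config π)) (n * L) := by
  refine ⟨h.route π hπ, ?_⟩
  rintro k ⟨s, hs, rfl⟩
  -- The network alone is its extension by an edgeless `H` without further vertices.
  exact ((h.extension (W := PEmpty.{1}) ⊥).1 π hπ).2 ⟨_, solves_map_inl hs ⊥, by simp⟩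

lemma IsLayered.succ_le_of_mem_solutionLengths (h : N.IsLayered L lvl) {π : Equiv.Perm (Fin n)}
    (hπ : Equiv.Perm.sign π ≠ 1) {k : ℕ} (hk : k ∈ solutionLengths N.graph (N.config π)) :
    n * L + 1 ≤ k := by
  obtain ⟨s, hs, rfl⟩ := hk
  refine (h.extension (W := PEmpty.{1}) ⊥).2.1 (delivered PEmpty.{1} π) ?_ _
    ⟨_, solves_map_inl hs ⊥, by simp⟩
  rintro ⟨ρ, hρ, he⟩
  refine hπ ?_
  have : π = ρ := by
    ext1 i
    exact Sum.inl_injective (DFunLike.congr_fun he (.inl i))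
  rw [this, hρ]

end Network

/-! ### Even permutations as products of full cycles -/

namespace Equiv.Perm

variable {α : Type*} [DecidableEq α]

/-- A permutation that permutes all elements cyclically (on at most one element: the identity). -/
def IsFullCycle (π : Equiv.Perm α) : Prop :=
  ∃ l : List α, l.Nodup ∧ (∀ x, x ∈ l) ∧ l.formPerm = π

lemma IsFullCycle.inv {π : Equiv.Perm α} (h : π.IsFullCycle) : π⁻¹.IsFullCycle := by
  obtain ⟨l, h1, h2, rfl⟩ := h
  exact ⟨l.reverse, by simpa, by simpa, List.formPerm_reverse l⟩

lemma IsFullCycle.exists_cons {π : Equiv.Perm α} (h : π.IsFullCycle) (x : α) :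
    ∃ l : List α, (x :: l).Nodup ∧ (∀ y, y ∈ x :: l) ∧ (x :: l).formPerm = π := by
  obtain ⟨l, h1, h2, rfl⟩ := h
  obtain ⟨l₁, l₂, rfl⟩ := List.append_of_mem (h2 x)
  refine ⟨l₂ ++ l₁, ?_, fun y => ?_, ?_⟩
  · have := (List.nodup_append_comm (l₁ := l₁) (l₂ := x :: l₂)).1 h1
    simpa using this
  · have := h2 y
    simp only [List.mem_append, List.mem_cons] at this ⊢
    tauto
  · have := List.formPerm_rotate (l₁ ++ x :: l₂) h1 l₁.length
    rw [List.rotate_append_length_eq] at this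
    simpa using this

/-- A product of two permutations that permute all elements cyclically. -/
def IsFullCycleMul (π : Equiv.Perm α) : Prop :=
  ∃ σ τ : Equiv.Perm α, σ.IsFullCycle ∧ τ.IsFullCycle ∧ π = σ * τ

lemma isFullCycleMul_one [Fintype α] : (1 : Equiv.Perm α).IsFullCycleMul := by
  have h : IsFullCycle (Finset.univ : Finset α).toList.formPerm :=
    ⟨_, Finset.nodup_toList _, by simp, rfl⟩
  exact ⟨_, _, h, h.inv, (mul_inv_cancel _).symm⟩

/-- The 3-cycle is the quotient of the full cycles `(x y z …)` and `(y x z …)`, whose common tail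
cancels. -/
lemma isFullCycleMul_swap_mul_swap [Fintype α] {x y z : α} (hxy : x ≠ y) (hxz : x ≠ z)
    (hyz : y ≠ z) : (swap y z * swap x y).IsFullCycleMul := by
  set l := (Finset.univ \ {x, y, z} : Finset α).toList with hl
  have hmem : ∀ w, w ∈ l ↔ w ≠ x ∧ w ≠ y ∧ w ≠ z := by simp [hl]
  have hnd : l.Nodup := Finset.nodup_toList _
  have h1 : IsFullCycle (x :: y :: z :: l).formPerm := by
    refine ⟨_, ?_, ?_, rfl⟩
    · simp [hmem, hnd, hxy, hxz, hyz]
    · intro w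
      simp only [List.mem_cons, hmem]
      tauto
  have h2 : IsFullCycle (y :: x :: z :: l).formPerm := by
    refine ⟨_, ?_, ?_, rfl⟩
    · simp [hmem, hnd, hxy.symm, hxz, hyz]
    · intro w
      simp only [List.mem_cons, hmem]
      tauto
  refine ⟨_, _, h1, h2.inv, ?_⟩
  simp only [List.formPerm_cons_cons, mul_inv_rev, swap_inv]
  have h3 : swap y z * swap x y = swap x y * (swap y z * (swap x z * swap y x)) := by
    ext w
    simp only [mul_apply, swap_apply_def]
    grind
  simp only [mul_assoc, mul_inv_cancel_left, h3]

/-- An even nontrivial permutation moves a third point `z` besides `x` and `π x`. Splitting off the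
3-cycle `x ↦ z ↦ π x ↦ x` leaves a permutation that fixes `x` and moves no new point. -/
lemma exists_isFullCycleMul_mul [Fintype α] {π : Equiv.Perm α} (hπ : sign π = 1) (h1 : π ≠ 1) :
    ∃ σ ρ : Equiv.Perm α, σ.IsFullCycleMul ∧ sign ρ = 1 ∧ ρ.support.card < π.support.card ∧
      π = σ * ρ := by
  obtain ⟨x, hx⟩ : ∃ x, π x ≠ x := by
    by_contra! h
    exact h1 (ext h)
  have hcard : 2 < π.support.card := by
    have h0 : π.support.card ≠ 0 := by simpa using h1
    have h2 := π.card_support_ne_one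
    have h3 : π.support.card ≠ 2 := fun h => by
      have := (card_support_eq_two.1 h).sign_eq
      rw [hπ] at this
      exact absurd this (by decide)
    omega
  obtain ⟨z, hz, hzx⟩ : ∃ z ∈ π.support, z ∉ ({x, π x} : Finset α) := by
    refine Finset.exists_mem_notMem_of_card_lt_card (lt_of_le_of_lt ?_ hcard)
    exact Finset.card_le_two
  simp only [Finset.mem_insert, Finset.mem_singleton, not_or] at hzx
  have hσ := isFullCycleMul_swap_mul_swap (Ne.symm hzx.1) hx.symm hzx.2
  refine ⟨_, (swap z (π x) * swap x z)⁻¹ * π, hσ, ?_, ?_, (mul_inv_cancel_left _ _).symm⟩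
  · rw [map_mul, hπ, map_inv, map_mul, sign_swap hzx.2, sign_swap (Ne.symm hzx.1)]
    simp
  · refine Finset.card_lt_card ((Finset.ssubset_iff_of_subset fun w hw => ?_).2 ⟨x, ?_, ?_⟩)
    · rw [mem_support] at hw ⊢
      intro hw'
      refine hw ?_
      have hwx : w ≠ x := by rintro rfl; exact hx hw'
      have hwz : w ≠ z := by rintro rfl; exact (mem_support.1 hz) hw'
      have hwy : w ≠ π x := by
        rintro rfl
        exact hx (π.injective hw')
      simp [hw', swap_apply_of_ne_of_ne, hwx, hwz, hwy]
    · exact mem_support.2 hx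
    · simp

lemma exists_list_isFullCycle [Fintype α] (k : ℕ) {π : Equiv.Perm α} (hπ : sign π = 1)
    (hk : π.support.card ≤ k) :
    ∃ l : List (Equiv.Perm α), l.length = 2 * k ∧ (∀ σ ∈ l, σ.IsFullCycle) ∧ l.prod = π := by
  induction k generalizing π with
  | zero =>
    have h : π = 1 := by simpa using hk
    exact ⟨[], rfl, by simp, h.symm⟩
  | succ k ih =>
    obtain ⟨σ, ρ, ⟨σ₁, σ₂, h1, h2, rfl⟩, hρ, hc, rfl⟩ : ∃ σ ρ : Equiv.Perm α,
        σ.IsFullCycleMul ∧ sign ρ = 1 ∧ ρ.support.card ≤ k ∧ π = σ * ρ := by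
      by_cases h : π = 1
      -- The length of the list must not depend on `π`, so it is padded with a full cycle and its
      -- inverse.
      · exact ⟨1, 1, isFullCycleMul_one, by simp, by simp, by simp [h]⟩
      · obtain ⟨σ, ρ, h1, h2, h3, h4⟩ := exists_isFullCycleMul_mul hπ h
        exact ⟨σ, ρ, h1, h2, by omega, h4⟩
    obtain ⟨l, hl, hl', rfl⟩ := ih hρ hc
    refine ⟨σ₁ :: σ₂ :: l, by simp [hl]; omega, ?_, by simp [mul_assoc]⟩
    simpa [h1, h2] using hl'

end Equiv.Perm

/-! ### Relaying tokens -/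

section Relay

variable {V α : Type*} [DecidableEq V]

/-- For every permutation `σ` in `S`, there is a sequence of `k` swaps in `G` that brings the
tokens on `a i` to `b (σ i)`, and whose effect on the other tokens does not depend on `σ`. -/
def Relays (G : SimpleGraph V) (a b : α → V) (k : ℕ) (S : Set (Equiv.Perm α)) : Prop :=
  ∃ g : V → V, ∀ σ ∈ S, ∃ s, IsSwapSeq G s ∧ s.length = k ∧
    (∀ i, (swapProd s)⁻¹ (a i) = b (σ i)) ∧ ∀ v ∉ Set.range a, (swapProd s)⁻¹ v = g v

lemma Relays.refl (G : SimpleGraph V) (a : α → V) : Relays G a a 0 {1} := by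
  refine ⟨id, fun σ hσ => ⟨[], by simp [IsSwapSeq], rfl, fun i => ?_, fun v _ => rfl⟩⟩
  rw [Set.mem_singleton_iff.1 hσ]
  rfl

lemma Relays.trans {G : SimpleGraph V} {a b c : α → V} {k l : ℕ} {S T : Set (Equiv.Perm α)}
    (h : Relays G a b k S) (h' : Relays G b c l T) :
    Relays G a c (k + l) {σ | ∃ τ ∈ T, ∃ ρ ∈ S, σ = τ * ρ} := by
  obtain ⟨f, hf⟩ := h
  obtain ⟨g, hg⟩ := h'
  refine ⟨g ∘ f, ?_⟩
  rintro σ ⟨τ, hτ, ρ, hρ, rfl⟩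
  obtain ⟨s, hs, hsl, hsa, hsf⟩ := hf ρ hρ
  obtain ⟨t, ht, htl, hta, htf⟩ := hg τ hτ
  refine ⟨s ++ t, fun e he => ?_, by simp [hsl, htl], fun i => ?_, fun v hv => ?_⟩
  · exact (List.mem_append.1 he).elim (hs e) (ht e)
  · rw [swapProd_append, mul_inv_rev, Equiv.Perm.mul_apply, hsa, hta]
    rfl
  · rw [swapProd_append, mul_inv_rev, Equiv.Perm.mul_apply, htf, hsf v hv]
    · rfl
    · rintro ⟨j, hj⟩
      refine hv ⟨ρ⁻¹ j, (swapProd s)⁻¹.injective ?_⟩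
      rw [hsa, ← hj]
      simp

/-- The tokens on `a x`, `x` running through a list, are sent one after the other through `z`, each
of them to `b y`, where `y` is the next element of the list, and the last one to `b e`. -/
def hubSwaps (a b : α → V) (z : V) (e : α) : α → List α → List (V × V)
  | x, [] => [(a x, z), (z, b e)]
  | x, y :: l => (a x, z) :: (z, b y) :: hubSwaps a b z e y l

omit [DecidableEq V] in
lemma length_hubSwaps (a b : α → V) (z : V) (e x : α) (l : List α) :
    (hubSwaps a b z e x l).length = 2 * (l.length + 1) := by
  induction l generalizing x with
  | nil => rfl
  | cons y l ih =>
    simp only [hubSwaps, List.length_cons, ih]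
    ring

omit [DecidableEq V] in
lemma isSwapSeq_hubSwaps {G : SimpleGraph V} {a b : α → V} {z : V} (ha : ∀ i, G.Adj (a i) z)
    (hb : ∀ i, G.Adj z (b i)) (e x : α) (l : List α) : IsSwapSeq G (hubSwaps a b z e x l) := by
  induction l generalizing x with
  | nil => simp [hubSwaps, IsSwapSeq, ha, hb]
  | cons y l ih =>
    have := ih y
    simp only [IsSwapSeq, hubSwaps, List.forall_mem_cons] at this ⊢
    exact ⟨ha x, hb y, this⟩

section Hub

variable {a b : α → V} {z : V}

lemma swapProd_hubSwaps_nil_inv (e x : α) :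
    (swapProd (hubSwaps a b z e x []))⁻¹ = Equiv.swap z (b e) * Equiv.swap (a x) z := by
  simp [hubSwaps]

lemma swapProd_hubSwaps_cons_inv (e x y : α) (l : List α) :
    (swapProd (hubSwaps a b z e x (y :: l)))⁻¹ =
      (swapProd (hubSwaps a b z e y l))⁻¹ * (Equiv.swap z (b y) * Equiv.swap (a x) z) := by
  simp [hubSwaps, mul_assoc]

lemma swapProd_hubSwaps_inv_apply_of_ne {v : V} (hz : v ≠ z) (e x : α) (l : List α)
    (ha : ∀ u ∈ x :: l, v ≠ a u) (hb : ∀ u ∈ e :: l, v ≠ b u) :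
    (swapProd (hubSwaps a b z e x l))⁻¹ v = v := by
  induction l generalizing x with
  | nil =>
    rw [swapProd_hubSwaps_nil_inv, Equiv.Perm.mul_apply,
      Equiv.swap_apply_of_ne_of_ne (ha x (by simp)) hz,
      Equiv.swap_apply_of_ne_of_ne hz (hb e (by simp))]
  | cons y l ih =>
    rw [swapProd_hubSwaps_cons_inv, Equiv.Perm.mul_apply, Equiv.Perm.mul_apply,
      Equiv.swap_apply_of_ne_of_ne (ha x (by simp)) hz,
      Equiv.swap_apply_of_ne_of_ne hz (hb y (by simp))]
    refine ih y (fun u hu => ha u (List.mem_cons_of_mem _ hu)) fun u hu => hb u ?_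
    simp only [List.mem_cons] at hu ⊢
    tauto

lemma swapProd_hubSwaps_inv_apply_hub (haz : ∀ i, a i ≠ z) (hab : ∀ i j, a i ≠ b j)
    (ha : a.Injective) {e x : α} {l : List α} (hl : (x :: l).Nodup) :
    (swapProd (hubSwaps a b z e x l))⁻¹ z = a x := by
  cases l with
  | nil =>
    rw [swapProd_hubSwaps_nil_inv, Equiv.Perm.mul_apply, Equiv.swap_apply_right,
      Equiv.swap_apply_of_ne_of_ne (haz x) (hab _ _)]
  | cons y l =>
    rw [swapProd_hubSwaps_cons_inv, Equiv.Perm.mul_apply, Equiv.Perm.mul_apply,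
      Equiv.swap_apply_right, Equiv.swap_apply_of_ne_of_ne (haz x) (hab _ _)]
    refine swapProd_hubSwaps_inv_apply_of_ne (haz x) _ _ _ (fun u hu h => ?_) fun u _ => hab _ _
    rw [ha h] at hl
    exact (List.nodup_cons.1 hl).1 hu

/-- The separate end `e` makes the induction work: the cycle of the tail closes at its own head `y`,
but the last token still goes to `b e`. The conditional redirects the closing arrow. -/
lemma swapProd_hubSwaps_inv_apply_source [DecidableEq α] (haz : ∀ i, a i ≠ z)
    (hbz : ∀ i, b i ≠ z) (hab : ∀ i j, a i ≠ b j) (ha : a.Injective) (hb : b.Injective)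
    {e x : α} {l : List α} (hl : (x :: l).Nodup) (he : e ∉ l) {u : α} (hu : u ∈ x :: l) :
    (swapProd (hubSwaps a b z e x l))⁻¹ (a u) =
      b (if (x :: l).formPerm u = x then e else (x :: l).formPerm u) := by
  induction l generalizing x with
  | nil =>
    obtain rfl : u = x := by simpa using hu
    rw [swapProd_hubSwaps_nil_inv, Equiv.Perm.mul_apply, Equiv.swap_apply_left,
      Equiv.swap_apply_left]
    simp
  | cons y l ih =>
    rw [swapProd_hubSwaps_cons_inv, Equiv.Perm.mul_apply, Equiv.Perm.mul_apply,
      List.formPerm_cons_cons, Equiv.Perm.mul_apply]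
    have hxl : x ∉ y :: l := (List.nodup_cons.1 hl).1
    have hl' := (List.nodup_cons.1 hl).2
    have hyx : y ≠ x := fun h => hxl (by simp [h])
    have hey : e ≠ y := fun h => he (by simp [h])
    rcases List.mem_cons.1 hu with rfl | hu'
    · rw [Equiv.swap_apply_left, Equiv.swap_apply_left,
        List.formPerm_apply_of_notMem hxl, Equiv.swap_apply_left, if_neg hyx]
      refine swapProd_hubSwaps_inv_apply_of_ne (hbz y) _ _ _ (fun w _ => (hab _ _).symm)
        fun w hw h => ?_
      rw [← hb h] at hw
      rcases List.mem_cons.1 hw with h | h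
      · exact hey h.symm
      · exact (List.nodup_cons.1 hl').1 h
    · have hux : u ≠ x := by rintro rfl; exact hxl hu'
      rw [Equiv.swap_apply_of_ne_of_ne (ha.ne hux) (haz u),
        Equiv.swap_apply_of_ne_of_ne (haz u) (hab _ _),
        ih hl' (fun h => he (List.mem_cons_of_mem _ h)) hu']
      have hmem : (y :: l).formPerm u ∈ y :: l := List.formPerm_apply_mem_of_mem hu'
      have hne : (y :: l).formPerm u ≠ x := fun h => hxl (h ▸ hmem)
      by_cases h : (y :: l).formPerm u = y
      · rw [if_pos h, h, Equiv.swap_apply_right, if_pos rfl]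
      · rw [if_neg h, Equiv.swap_apply_of_ne_of_ne hne h, if_neg hne]

/-- The token on `b u` is pushed to the hub when the preceding token arrives, and on to `a u` when
the token of `a u` departs. -/
lemma swapProd_hubSwaps_inv_apply_target (haz : ∀ i, a i ≠ z)
    (hbz : ∀ i, b i ≠ z) (hab : ∀ i j, a i ≠ b j) (ha : a.Injective) (hb : b.Injective)
    {e x : α} {l : List α} (hl : (x :: l).Nodup) {u : α} (hu : u ∈ l) :
    (swapProd (hubSwaps a b z e x l))⁻¹ (b u) = a u := by
  induction l generalizing x with
  | nil => simp at hu
  | cons y l ih =>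
    rw [swapProd_hubSwaps_cons_inv, Equiv.Perm.mul_apply, Equiv.Perm.mul_apply,
      Equiv.swap_apply_of_ne_of_ne (hab _ _).symm (hbz u)]
    have hl' := (List.nodup_cons.1 hl).2
    rcases List.mem_cons.1 hu with rfl | hu'
    · rw [Equiv.swap_apply_right, swapProd_hubSwaps_inv_apply_hub haz hab ha hl']
    · have huy : u ≠ y := by rintro rfl; exact (List.nodup_cons.1 hl').1 hu'
      rw [Equiv.swap_apply_of_ne_of_ne (hbz u) (hb.ne huy), ih hl' hu']

lemma swapProd_hubSwaps_inv_apply_last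
    (hbz : ∀ i, b i ≠ z) (hab : ∀ i j, a i ≠ b j) (hb : b.Injective)
    {e x : α} {l : List α} (he : e ∉ l) :
    (swapProd (hubSwaps a b z e x l))⁻¹ (b e) = z := by
  induction l generalizing x with
  | nil =>
    rw [swapProd_hubSwaps_nil_inv, Equiv.Perm.mul_apply,
      Equiv.swap_apply_of_ne_of_ne (hab _ _).symm (hbz e), Equiv.swap_apply_right]
  | cons y l ih =>
    rw [swapProd_hubSwaps_cons_inv, Equiv.Perm.mul_apply, Equiv.Perm.mul_apply,
      Equiv.swap_apply_of_ne_of_ne (hab _ _).symm (hbz e),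
      Equiv.swap_apply_of_ne_of_ne (hbz e) (hb.ne fun h => he (by simp [h])),
      ih fun h => he (List.mem_cons_of_mem _ h)]

end Hub

lemma relays_isFullCycle [Fintype α] [DecidableEq α] {G : SimpleGraph V} {a b : α → V} {z : V}
    (x : α) (ha : a.Injective) (hb : b.Injective) (hab : ∀ i j, a i ≠ b j)
    (haz : ∀ i, G.Adj (a i) z) (hzb : ∀ i, G.Adj z (b i)) :
    Relays G a b (2 * Fintype.card α) {σ | σ.IsFullCycle} := by
  classical
  have haz' : ∀ i, a i ≠ z := fun i => (haz i).ne
  have hbz' : ∀ i, b i ≠ z := fun i => (hzb i).ne'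
  -- The hub token goes to `a x`, the one on `b x` to the hub, and every other one on `b i` to `a
  -- i`. Only the starting element `x` enters, and it is the same for every cycle.
  refine ⟨fun v => if v = z then a x else if h : ∃ i, v = b i then
    if h.choose = x then z else a h.choose else v, fun σ hσ => ?_⟩
  obtain ⟨l, hnd, hmem, rfl⟩ := Equiv.Perm.IsFullCycle.exists_cons hσ x
  have hxl : x ∉ l := (List.nodup_cons.1 hnd).1
  refine ⟨hubSwaps a b z x x l, isSwapSeq_hubSwaps haz hzb _ _ _, ?_, fun i => ?_, fun v hv => ?_⟩
  · have h1 : (x :: l).toFinset = Finset.univ := by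
      ext y
      simpa using hmem y
    have h2 := List.toFinset_card_of_nodup hnd
    rw [h1, Finset.card_univ, List.length_cons] at h2
    rw [length_hubSwaps, h2]
  · rw [swapProd_hubSwaps_inv_apply_source haz' hbz' hab ha hb hnd hxl (hmem i)]
    split_ifs with h
    · rw [h]
    · rfl
  · beta_reduce
    split_ifs with h1 h2 h3
    · rw [h1, swapProd_hubSwaps_inv_apply_hub haz' hab ha hnd]
    · have := h2.choose_spec
      rw [h3] at this
      rw [this, swapProd_hubSwaps_inv_apply_last hbz' hab hb hxl]
    · have := h2.choose_spec
      conv_lhs => rw [this]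
      refine swapProd_hubSwaps_inv_apply_target haz' hbz' hab ha hb hnd ?_
      exact (List.mem_cons.1 (hmem _)).resolve_left h3
    · refine swapProd_hubSwaps_inv_apply_of_ne h1 _ _ _ (fun u _ h => hv ⟨u, h.symm⟩) ?_
      exact fun u _ h => h2 ⟨u, h⟩

end Relay

/-! ### Construction of the network -/

namespace Network

variable {n m : ℕ}

/-- The common effect `g` on the other tokens serves as the filler destinations. It avoids the
outputs because the tokens from the inputs already fill them. -/
lemma exists_config_eq {G : SimpleGraph (NetVertex n m)} {k : ℕ} {S : Set (Equiv.Perm (Fin n))}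
    (h : Relays G NetVertex.input NetVertex.output k S) (hS : S.Nonempty) :
    ∃ N : Network n m, N.graph = G ∧
      ∀ π ∈ S, ∃ s, Solves G (N.config π) s ∧ s.length = k := by
  obtain ⟨g, hg⟩ := h
  obtain ⟨ρ, hρ⟩ := hS
  obtain ⟨s, -, -, hsi, hsg⟩ := hg ρ hρ
  let src : Fin m ⊕ Fin n → NetVertex n m := Sum.elim .inner .output
  let tgt : Fin n ⊕ Fin m → NetVertex n m := Sum.elim .input .inner
  have hsrc : ∀ x, src x ∉ Set.range NetVertex.input := by
    rintro (j | j) ⟨i, hi⟩ <;> simp [src] at hi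
  have hsrc' : src.Injective := by
    rintro (_ | _) (_ | _) h <;> simp_all [src]
  have hex : ∀ x, ∃ y, tgt y = g (src x) := by
    intro x
    rcases hx : g (src x) with i | j | k
    · exact ⟨.inl i, rfl⟩
    · exact ⟨.inr j, rfl⟩
    · exfalso
      rw [← hsg _ (hsrc x)] at hx
      have h1 : (swapProd s)⁻¹ (.input (ρ⁻¹ k)) = .output k := by
        rw [hsi]
        simp
      exact hsrc x ⟨_, (swapProd s)⁻¹.injective (h1.trans hx.symm)⟩
  choose d hd using hex
  have hdinj : d.Injective := by
    intro x y hxy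
    have h1 : g (src x) = g (src y) := by rw [← hd, ← hd, hxy]
    rw [← hsg _ (hsrc x), ← hsg _ (hsrc y)] at h1
    exact hsrc' ((swapProd s)⁻¹.injective h1)
  have hdbij : d.Bijective :=
    (Fintype.bijective_iff_injective_and_card d).2 ⟨hdinj, by simp [add_comm]⟩
  let N : Network n m := ⟨G, Equiv.ofBijective d hdbij⟩
  have hN : ∀ x, N.fillerVertex x = g (src x) := by
    intro x
    rw [← hd]
    simp only [fillerVertex, N, Equiv.ofBijective_apply, tgt]
    cases d x <;> rfl
  refine ⟨N, rfl, fun π hπ => ?_⟩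
  obtain ⟨t, ht, htl, hti, htg⟩ := hg π hπ
  refine ⟨t, ⟨ht, ?_⟩, htl⟩
  have hc : N.config π = (swapProd t)⁻¹ := by
    funext v
    rcases v with i | j | k
    · exact (hti i).symm
    · exact (hN _).trans (htg _ (hsrc (.inl j))).symm
    · exact (hN _).trans (htg _ (hsrc (.inr k))).symm
  rw [applySwaps_eq_comp_swapProd, hc]
  funext v
  simp

/-- The level of a vertex, where the inner vertices form `r` levels of size `n`. -/
def level (n r : ℕ) : NetVertex n (r * n) → ℕ
  | .input _ => 0
  | .inner j => (finProdFinEquiv.symm j).1 + 1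
  | .output _ => r + 1

/-- The `i`-th vertex on level `l`. -/
def levelVertex {n : ℕ} (r l : ℕ) (i : Fin n) : NetVertex n (r * n) :=
  if l = 0 then .input i else
    if h : l - 1 < r then .inner (finProdFinEquiv (⟨l - 1, h⟩, i)) else .output i

/-- The position of a vertex on its level. -/
def column (n r : ℕ) : NetVertex n (r * n) → Fin n
  | .input i => i
  | .inner j => (finProdFinEquiv.symm j).2
  | .output i => i

variable {r : ℕ}

lemma level_levelVertex {l : ℕ} (hl : l ≤ r + 1) (i : Fin n) :
    level n r (levelVertex r l i) = l := by
  unfold levelVertex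
  split_ifs with h1 h2
  · simp [level, h1]
  · simp only [level, Equiv.symm_apply_apply]
    omega
  · simp only [level]
    omega

lemma levelVertex_injective (l : ℕ) : Function.Injective (levelVertex (n := n) r l) := by
  refine Function.LeftInverse.injective (g := column n r) fun i => ?_
  unfold levelVertex
  split_ifs <;> simp [column]

/-- The graph in which all vertices on consecutive levels are adjacent. -/
def levelGraph (n r : ℕ) : SimpleGraph (NetVertex n (r * n)) where
  Adj u v := level n r u = level n r v + 1 ∨ level n r v = level n r u + 1
  symm := ⟨fun _ _ h => h.symm⟩
  loopless := ⟨fun _ h => by omega⟩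

lemma levelGraph_preconnected (n r : ℕ) : (levelGraph n r).Preconnected := by
  rcases n.eq_zero_or_pos with rfl | hn
  · rintro (i | j | k)
    · exact i.elim0
    · exact (finProdFinEquiv.symm j).2.elim0
    · exact k.elim0
  · have key : ∀ l, ∀ v, level n r v = l →
        (levelGraph n r).Reachable v (levelVertex r 1 ⟨0, hn⟩) := by
      have h0 := level_levelVertex (r := r) (l := 0) (by omega) ⟨0, hn⟩
      have h1 := level_levelVertex (r := r) (l := 1) (by omega) ⟨0, hn⟩
      have hz : ∀ v, level n r v = 0 →
          (levelGraph n r).Reachable v (levelVertex r 1 ⟨0, hn⟩) := fun v hv =>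
        SimpleGraph.Adj.reachable (Or.inr (by rw [h1, hv]))
      intro l
      induction l with
      | zero => exact hz
      | succ l ih =>
        intro v hv
        have hlr : l ≤ r + 1 := by
          rcases v with i | j | k
          · simp [level] at hv
          · simp only [level] at hv
            have := (finProdFinEquiv.symm j).1.2
            omega
          · simp only [level] at hv
            omega
        have hl := level_levelVertex hlr ⟨0, hn⟩
        refine SimpleGraph.Reachable.trans (SimpleGraph.Adj.reachable (Or.inl ?_)) (ih _ hl)
        rw [hl, hv]
    exact fun u v => (key _ u rfl).trans (key _ v rfl).symm

lemma relays_levelGraph (k : ℕ) (hk : 2 * k ≤ r + 1) :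
    Relays (levelGraph n r) (levelVertex r 0) (levelVertex r (2 * k)) (k * (2 * n))
      {σ | ∃ l : List (Equiv.Perm (Fin n)), l.length = k ∧ (∀ τ ∈ l, τ.IsFullCycle) ∧
        l.prod = σ} := by
  induction k with
  | zero =>
    rw [zero_mul]
    convert Relays.refl (levelGraph n r) (levelVertex r 0) using 1
    ext σ
    constructor
    · rintro ⟨l, h1, -, rfl⟩
      rw [List.eq_nil_of_length_eq_zero h1]
      rfl
    · rintro rfl
      exact ⟨[], rfl, by simp, rfl⟩
  | succ k ih =>
    -- One full cycle takes two levels, with a single vertex of the level between as the hub.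
    have hslab : Relays (levelGraph n r) (levelVertex r (2 * k)) (levelVertex r (2 * (k + 1)))
        (2 * n) {σ | σ.IsFullCycle} := by
      rcases n.eq_zero_or_pos with rfl | hn
      · exact ⟨id, fun σ _ => ⟨[], by simp [IsSwapSeq], rfl, fun i => i.elim0, fun v _ => rfl⟩⟩
      · have h0 := fun i : Fin n => level_levelVertex (r := r) (l := 2 * k) (by omega) i
        have h1 := level_levelVertex (r := r) (l := 2 * k + 1) (by omega) ⟨0, hn⟩
        have h2 := fun i : Fin n => level_levelVertex (r := r) (l := 2 * (k + 1)) hk i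
        have := relays_isFullCycle (G := levelGraph n r) (z := levelVertex r (2 * k + 1) ⟨0, hn⟩)
          (⟨0, hn⟩ : Fin n) (levelVertex_injective (r := r) (2 * k))
          (levelVertex_injective (r := r) (2 * (k + 1)))
          (fun i j h => by
            have h3 := h0 i
            rw [h, h2] at h3
            omega)
          (fun i => Or.inr (by rw [h0, h1])) (fun i => Or.inr (by rw [h1, h2]; ring))
        rwa [Fintype.card_fin] at this
    have := (ih (by omega)).trans hslab
    rw [show (k + 1) * (2 * n) = k * (2 * n) + 2 * n by ring]
    obtain ⟨g, hg⟩ := this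
    refine ⟨g, ?_⟩
    rintro _ ⟨l, hl, hc, rfl⟩
    cases l with
    | nil => simp at hl
    | cons τ l =>
      refine hg _ ⟨τ, hc τ (by simp), l.prod, ⟨l, by simpa using hl, ?_, rfl⟩, by simp⟩
      exact fun ρ hρ => hc ρ (List.mem_cons_of_mem _ hρ)

lemma exists_isLayered (n : ℕ) : ∃ r ≤ 4 * n, ∃ N : Network n (r * n),
    N.graph.Preconnected ∧ N.IsLayered (r + 1) (level n r) := by
  -- The `2 * n` full cycles climb `4 * n` levels, the last being the outputs. For `n = 0` the
  -- subtraction truncates and `L = 1`, which is harmless as `n * L = 0`.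
  refine ⟨4 * n - 1, by omega, ?_⟩
  have hrel := relays_levelGraph (n := n) (r := 4 * n - 1) (2 * n) (by omega)
  have h0 : levelVertex (n := n) (4 * n - 1) 0 = NetVertex.input := rfl
  have h1 : levelVertex (n := n) (4 * n - 1) (2 * (2 * n)) = NetVertex.output := by
    funext i
    have := i.2
    unfold levelVertex
    rw [if_neg (by omega), dif_neg (by omega)]
  rw [h0, h1] at hrel
  have hmem : ∀ π : Equiv.Perm (Fin n), Equiv.Perm.sign π = 1 →
      ∃ l : List (Equiv.Perm (Fin n)), l.length = 2 * n ∧ (∀ τ ∈ l, τ.IsFullCycle) ∧ l.prod = π :=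
    fun π hπ => Equiv.Perm.exists_list_isFullCycle n hπ
      ((Finset.card_le_univ _).trans (Fintype.card_fin n).le)
  obtain ⟨N, hN, hsol⟩ := exists_config_eq hrel ⟨1, hmem 1 (by simp)⟩
  refine ⟨N, hN ▸ levelGraph_preconnected n _, fun i => rfl, fun k => rfl, ?_, fun π hπ => ?_⟩
  · rw [hN]
    exact fun u v h => h
  · obtain ⟨s, hs, hl⟩ := hsol π (hmem π hπ)
    refine ⟨s, hN ▸ hs, hl.trans ?_⟩
    rcases n.eq_zero_or_pos with rfl | hn
    · rfl
    · rw [Nat.sub_add_cancel (by omega)]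
      ring

end Network

/-! ### The theorem -/

theorem lemma5 :
    ∃ C : ℕ, ∀ n : ℕ, ∃ m : ℕ, m ≤ C * n ^ 3 ∧ ∃ (N : Network n m) (T : ℕ),
      -- the network is a connected graph (empty for `n = 0`), without edges between two inputs
      N.graph.Preconnected ∧
      (∀ i j : Fin n, ¬ N.graph.Adj (NetVertex.input i) (NetVertex.input j)) ∧
      -- even assignments cost exactly `T`
      (∀ π : Equiv.Perm (Fin n), Equiv.Perm.sign π = 1 →
        IsLeast (solutionLengths N.graph (N.config π)) T) ∧
      -- all other assignments cost at least `T + 1`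
      (∀ π : Equiv.Perm (Fin n), Equiv.Perm.sign π ≠ 1 →
        ∀ k ∈ solutionLengths N.graph (N.config π), T + 1 ≤ k) ∧
      -- the same in every extension
      (∀ (W : Type*) [Finite W] [DecidableEq W] (H : SimpleGraph (Fin n ⊕ W)),
        (∀ π : Equiv.Perm (Fin n), Equiv.Perm.sign π = 1 →
          IsLeast (solutionLengths (N.extend H) (N.extConfig (Network.delivered W π))) T) ∧
        (∀ τ : Equiv.Perm (Fin n ⊕ W),
          (¬ ∃ π : Equiv.Perm (Fin n), Equiv.Perm.sign π = 1 ∧ τ = Network.delivered W π) →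
          ∀ k ∈ solutionLengths (N.extend H) (N.extConfig τ), T + 1 ≤ k) ∧
        -- an even delivery to the inputs within `H` is completed by `T` swaps in the network
        (∀ (τ : Equiv.Perm (Fin n ⊕ W)) (π : Equiv.Perm (Fin n)), Equiv.Perm.sign π = 1 →
          ∀ h, IsSwapSeq (Network.hostGraph m H) h →
            applySwaps (N.extConfig τ) h = N.extConfig (Network.delivered W π) →
            ∃ p, IsSwapSeq (N.netGraph W) p ∧ p.length = T ∧
              Solves (N.extend H) (N.extConfig τ) (h ++ p)) ∧
        -- every solution makes at least `T` swaps in the network, and at least `T + 1` unless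
        -- its swaps in `H` make an even delivery to the inputs
        (∀ (τ : Equiv.Perm (Fin n ⊕ W))
            (s : List ((NetVertex n m ⊕ W) × (NetVertex n m ⊕ W))),
          Solves (N.extend H) (N.extConfig τ) s →
            T ≤ (N.netSwaps s).length ∧
            ((¬ ∃ π : Equiv.Perm (Fin n), Equiv.Perm.sign π = 1 ∧
                applySwaps (N.extConfig τ) (Network.hostSwaps H s) =
                  N.extConfig (Network.delivered W π)) →
              T + 1 ≤ (N.netSwaps s).length))) := by
  refine ⟨4, fun n => ?_⟩
  obtain ⟨r, hr, N, hN, h⟩ := Network.exists_isLayered n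
  refine ⟨r * n, ?_, N, n * (r + 1), hN, fun i j hij => ?_, fun π hπ => h.isLeast_solutionLengths hπ,
    fun π hπ k hk => h.succ_le_of_mem_solutionLengths hπ hk, fun W _ _ H => h.extension H⟩
  -- The construction is in fact quadratic in `n`.
  · calc r * n ≤ 4 * n * n := Nat.mul_le_mul_right n hr
      _ = 4 * n ^ 2 := by ring
      _ ≤ 4 * n ^ 3 := by
        rcases n.eq_zero_or_pos with rfl | hn
        · simp
        · exact Nat.mul_le_mul_left 4 (Nat.pow_le_pow_right hn (by norm_num))
  · have := h.adj _ _ hij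
    rw [h.input, h.input] at this
    omega
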